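/- **Setting.** Let $(M,h,\nabla)$ be a connected dually flat manifold of dimension $n$: $h$ is a Riemannian metric, $\nabla$ is an affine connection, and both $\nabla$ and its dual connection $\nabla^{*}$, defined by $X(h(Y,Z))=h(\nabla_XY,Z)+h(Y,\nabla^{*}_XZ)$, have vanishing torsion and curvature. Let $K:TTM\to TM$ be the connector of $\nabla$. Identify $T_u(TM)$ with $T_pM\oplus T_pM$ ($u\in T_pM$) by $A\mapsto(\pi_*A,KA)$. The tangent bundle $TM$ carries the Kähler structure $J(v,w)=(-w,v)$, $g((v,w),(v',w'))=h(v,v')+h(w,w')$. Suppose $X=(X_1,\dots,X_n)$ is a frame of $\nabla$-parallel vector fields on $M$, generating the parallel lattice $L=\{\sum k_iX_i(p)\mid k\in\mathbb{Z}^n,\ p\in M\}$. Let $\Gamma(L)$ be the group of translations $u\mapsto u+\sum k_iX_i$, $k\in\mathbb{Z}^n$, of $TM$, and let $q_L:TM\to M_L=TM/\Gamma(L)$ be the quotient map. Give $M_L$ the induced Kähler structure and the action $\Phi_X([t],q_L(u))=q_L(u+\sum t_iX_i)$ of the torus $\mathbb{T}^n=\mathbb{R}^n/\mathbb{Z}^n$.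 Let $(N,g)$ be a compact Kähler manifold of complex dimension $n$, which is regular: connected, simply connected, complete, with real analytic Kähler metric. Let $\mathrm{Aut}(N,g)$ be the group of holomorphic isometries of $(N,g)$. Let $\Phi:\mathbb{T}^n\times N\to N$ be a smooth effective torus action by holomorphic isometries $\Phi_a$. Let $N^{\circ}$ be the set of points at which $\Phi$ is free. Assume that $\Phi$ is a torification of $(M,h,\nabla)$: there are a parallel lattice $L\subset TM$, a generator $X$ of $L$ and a holomorphic isometric diffeomorphism $F:M_L\to N^{\circ}$ with $F\circ(\Phi_X)_a=\Phi_a\circ F$ for all $a\in\mathbb{T}^n$. **Statement.** Let $S=\{\Phi_a\mid a\in\mathbb{T}^n\}\subset\mathrm{Aut}(N,g)$, and let $N(S)=\{\varphi\in\mathrm{Aut}(N,g)\mid\varphi S\varphi^{-1}=S\}$ be its normalizer. Let $\mathrm{Aut}(N,g)^{\mathbb{T}^n}$ be the group of those $\varphi\in\mathrm{Aut}(N,g)$ for which there is a Lie group isomorphism $\rho:\mathbb{T}^n\to\mathbb{T}^n$ (a group isomorphism, smooth together with its inverse) such that $\varphi\circ\Phi_a=\Phi_{\rho(a)}\circ\varphi$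 for all $a\in\mathbb{T}^n$. Then $$N(S)=\mathrm{Aut}(N,g)^{\mathbb{T}^n}.$$ Moreover, for every $\varphi\in N(S)$ there is exactly one map $\rho:\mathbb{T}^n\to\mathbb{T}^n$ with $\varphi\circ\Phi_a=\Phi_{\rho(a)}\circ\varphi$ for all $a$, and this $\rho$ is a Lie group isomorphism; in particular it is smooth. -/

import Mathlib

open scoped Manifold ContDiff Bundle Topology

noncomputable section

namespace Torification

/-! ### The torus `𝕋ⁿ = ℝⁿ / ℤⁿ`, realised as the Lie group `(S¹)ⁿ` -/

/-- The `n`-dimensional torus, with its product group structure and product smooth structure. -/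
abbrev Torus (n : ℕ) : Type := Fin n → Circle

/-- The model with corners of the smooth manifold `Torus n`. -/
abbrev torusModel (n : ℕ) :
    ModelWithCorners ℝ (Fin n → EuclideanSpace ℝ (Fin 1))
      (ModelPi fun _ : Fin n => EuclideanSpace ℝ (Fin 1)) :=
  ModelWithCorners.pi fun _ : Fin n => 𝓡 1

/-- The class `[t]` of `t ∈ ℝⁿ` in `ℝⁿ / ℤⁿ`, that is `(exp (2πi t₁), …, exp (2πi tₙ))`. -/
def torusMk {n : ℕ} (t : Fin n → ℝ) : Torus n := fun i => Circle.exp (2 * Real.pi * t i)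

/-- A Lie group isomorphism of the torus: a group isomorphism, smooth in both directions. -/
def IsLieGroupIso {n : ℕ} (ρ : Torus n ≃* Torus n) : Prop :=
  ContMDiff (torusModel n) (torusModel n) ∞ ρ ∧ ContMDiff (torusModel n) (torusModel n) ∞ ρ.symm

/-! ### Complex manifolds, Kähler metrics and holomorphic isometries -/

section Kahler

variable {V : Type*} [NormedAddCommGroup V] [NormedSpace ℂ V]
  {N : Type*} [TopologicalSpace N] [ChartedSpace V N]

/-- A complex manifold is a real analytic manifold (with the same atlas). -/
instance isManifold_real [IsManifold 𝓘(ℂ, V) ω N] : IsManifold 𝓘(ℝ, V) ω N := by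
  refine isManifold_of_contDiffOn _ _ _ fun e e' he he' => ?_
  have h := (contDiffGroupoid ω 𝓘(ℂ, V)).compatible he he'
  rw [contDiffGroupoid, mem_groupoid_of_pregroupoid] at h
  have h1 := h.1
  simp only [contDiffPregroupoid, ContDiffOn] at h1
  exact fun x hx => (h1 x (by simpa using hx)).restrict_scalars ℝ

theorem mdifferentiableAt_real {W : Type*} [NormedAddCommGroup W] [NormedSpace ℂ W]
    {P : Type*} [TopologicalSpace P] [ChartedSpace W P] {f : N → P} {x : N}
    (hf : MDifferentiableAt 𝓘(ℂ, V) 𝓘(ℂ, W) f x) : MDifferentiableAt 𝓘(ℝ, V) 𝓘(ℝ, W) f x := by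
  rw [mdifferentiableAt_iff] at hf ⊢
  exact ⟨hf.1, hf.2.restrictScalars ℝ⟩

/-- The complex structure of a complex manifold: multiplication by `i` on the (real) tangent
spaces. -/
def complexStructure (x : N) : TangentSpace 𝓘(ℝ, V) x →L[ℝ] TangentSpace 𝓘(ℝ, V) x :=
  (Complex.I • ContinuousLinearMap.id ℝ V : V →L[ℝ] V)

/-- The expression `ω(v, w) = g(Jv, w)` in a chart `e`, at the point `y` of the chart domain in
`V`, of the fundamental two-form of a family `g` of bilinear forms on the tangent spaces. -/
def fundamentalForm
    (g : ∀ x : N, TangentSpace 𝓘(ℝ, V) x →L[ℝ] TangentSpace 𝓘(ℝ, V) x →L[ℝ] ℝ)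
    (e : OpenPartialHomeomorph N V) (y v w : V) : ℝ :=
  g (e.symm y) (complexStructure (e.symm y) (mfderiv 𝓘(ℝ, V) 𝓘(ℝ, V) e.symm y v))
    (mfderiv 𝓘(ℝ, V) 𝓘(ℝ, V) e.symm y w)

variable (V N) in
/-- A (smooth) Kähler metric on a complex manifold `N`: a smooth Riemannian metric for which the
complex structure is isometric and whose fundamental two-form `ω` is closed. Closedness is
expressed in charts, by
`dω(u, v, w) = ∂ᵤ ω(v, w) - ∂ᵥ ω(u, w) + ∂_w ω(u, v)` for constant vector fields `u, v, w`. -/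
structure KahlerMetric [IsManifold 𝓘(ℂ, V) ω N] where
  /-- The underlying Riemannian metric. -/
  metric : Bundle.ContMDiffRiemannianMetric 𝓘(ℝ, V) ∞ V (fun x : N => TangentSpace 𝓘(ℝ, V) x)
  hermitian : ∀ (x : N) (v w : TangentSpace 𝓘(ℝ, V) x),
    metric.inner x (complexStructure x v) (complexStructure x w) = metric.inner x v w
  closed : ∀ e ∈ atlas V N, ∀ y ∈ e.target, ∀ u v w : V,
    fderiv ℝ (fun z => fundamentalForm metric.inner e z v w) y u
      - fderiv ℝ (fun z => fundamentalForm metric.inner e z u w) y v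
      + fderiv ℝ (fun z => fundamentalForm metric.inner e z u v) y w = 0

variable [IsManifold 𝓘(ℂ, V) ω N]

/-- The Kähler metric is real analytic. -/
def KahlerMetric.IsRealAnalytic (g : KahlerMetric V N) : Prop :=
  ContMDiff 𝓘(ℝ, V) (𝓘(ℝ, V).prod 𝓘(ℝ, V →L[ℝ] V →L[ℝ] ℝ)) ω
    (fun x : N => Bundle.TotalSpace.mk' (V →L[ℝ] V →L[ℝ] ℝ)
      (E := fun x : N => TangentSpace 𝓘(ℝ, V) x →L[ℝ] TangentSpace 𝓘(ℝ, V) x →L[ℝ] ℝ)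
      x (g.metric.inner x))

/-- The Kähler metric is complete: Cauchy sequences for its Riemannian distance converge. -/
def KahlerMetric.IsComplete (g : KahlerMetric V N) : Prop :=
  letI : Bundle.RiemannianBundle (fun x : N => TangentSpace 𝓘(ℝ, V) x) :=
    ⟨g.metric.toRiemannianMetric⟩
  ∀ u : ℕ → N,
    (∀ ε : ENNReal, 0 < ε → ∃ K : ℕ, ∀ i ≥ K, ∀ j ≥ K,
      Manifold.riemannianEDist 𝓘(ℝ, V) (u i) (u j) < ε) →
    ∃ x : N, Filter.Tendsto u Filter.atTop (𝓝 x)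

/-- A Kähler manifold is regular if it is connected, simply connected and complete, and if the
Kähler metric is real analytic. -/
structure KahlerMetric.IsRegular (g : KahlerMetric V N) : Prop where
  connected : ConnectedSpace N
  simplyConnected : SimplyConnectedSpace N
  complete : g.IsComplete
  analytic : g.IsRealAnalytic

/-- `Aut(N, g)`, the group of holomorphic isometries of the Kähler manifold `(N, g)`. -/
def KahlerMetric.aut (g : KahlerMetric V N) : Subgroup (Equiv.Perm N) where
  carrier := {φ | MDifferentiable 𝓘(ℂ, V) 𝓘(ℂ, V) φ ∧ MDifferentiable 𝓘(ℂ, V) 𝓘(ℂ, V) φ.symm ∧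
    ∀ (x : N) (v w : TangentSpace 𝓘(ℝ, V) x),
      g.metric.inner (φ x) (mfderiv 𝓘(ℝ, V) 𝓘(ℝ, V) φ x v) (mfderiv 𝓘(ℝ, V) 𝓘(ℝ, V) φ x w)
        = g.metric.inner x v w}
  one_mem' := by
    refine ⟨mdifferentiable_id, mdifferentiable_id, fun x v w => ?_⟩
    have : mfderiv 𝓘(ℝ, V) 𝓘(ℝ, V) (⇑(1 : Equiv.Perm N)) x = ContinuousLinearMap.id ℝ _ :=
      mfderiv_id
    rw [this]
    rfl
  mul_mem' := by
    rintro φ ψ ⟨hφ, hφ', hφg⟩ ⟨hψ, hψ', hψg⟩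
    refine ⟨hφ.comp hψ, hψ'.comp hφ', fun x v w => ?_⟩
    have : mfderiv 𝓘(ℝ, V) 𝓘(ℝ, V) (⇑(φ * ψ)) x = (mfderiv 𝓘(ℝ, V) 𝓘(ℝ, V) φ (ψ x)).comp
        (mfderiv 𝓘(ℝ, V) 𝓘(ℝ, V) ψ x) :=
      mfderiv_comp x (mdifferentiableAt_real (hφ _)) (mdifferentiableAt_real (hψ _))
    rw [this]
    exact (hφg _ _ _).trans (hψg _ _ _)
  inv_mem' := by
    rintro φ ⟨hφ, hφ', hφg⟩
    refine ⟨hφ', hφ, fun x v w => ?_⟩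
    have hcomp : (mfderiv 𝓘(ℝ, V) 𝓘(ℝ, V) φ (φ.symm x)).comp
        (mfderiv 𝓘(ℝ, V) 𝓘(ℝ, V) φ.symm x) = ContinuousLinearMap.id ℝ V := by
      refine (mfderiv_comp x (mdifferentiableAt_real (hφ _)) (mdifferentiableAt_real (hφ' _))).symm.trans ?_
      rw [show (⇑φ ∘ ⇑φ.symm : N → N) = id from funext φ.apply_symm_apply]
      exact mfderiv_id
    have hx : ∀ z : N, z = x → ∀ a b : V,
        (g.metric.inner z : V →L[ℝ] V →L[ℝ] ℝ) a b = (g.metric.inner x : V →L[ℝ] V →L[ℝ] ℝ) a b := by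
      rintro z rfl a b
      rfl
    have hv : ∀ v : V, (mfderiv 𝓘(ℝ, V) 𝓘(ℝ, V) φ (φ.symm x) : V →L[ℝ] V)
        ((mfderiv 𝓘(ℝ, V) 𝓘(ℝ, V) φ.symm x : V →L[ℝ] V) v) = v := fun v => DFunLike.congr_fun hcomp v
    have h := hφg (φ.symm x) (mfderiv 𝓘(ℝ, V) 𝓘(ℝ, V) φ.symm x v)
      (mfderiv 𝓘(ℝ, V) 𝓘(ℝ, V) φ.symm x w)
    refine h.symm.trans ((hx _ (φ.apply_symm_apply x) _ _).trans ?_)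
    exact congrArg₂ (fun a b => (g.metric.inner x : V →L[ℝ] V →L[ℝ] ℝ) a b) (hv v) (hv w)

/-! ### Torus actions by holomorphic isometries -/

/-- A homomorphism `Φ : 𝕋ⁿ → Aut(N, g)` is an effective holomorphic and isometric torus action if
the map `(a, p) ↦ Φₐ(p)` is smooth and `Φ` is injective. -/
structure IsEffectiveTorusAction {n : ℕ} (g : KahlerMetric V N) (Φ : Torus n →* g.aut) : Prop where
  smooth : ContMDiff ((torusModel n).prod 𝓘(ℝ, V)) 𝓘(ℝ, V) ∞
    (fun q : Torus n × N => (Φ q.1 : Equiv.Perm N) q.2)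
  effective : Function.Injective Φ

/-- `N°`, the set of points at which the torus action is free. -/
def freeLocus {n : ℕ} {g : KahlerMetric V N} (Φ : Torus n →* g.aut) : Set N :=
  {p | ∀ a : Torus n, (Φ a : Equiv.Perm N) p = p → a = 1}

/-- `Aut(N, g)^{𝕋ⁿ}`, the group of holomorphic isometries `φ` for which there is a Lie group
isomorphism `ρ` of the torus with `φ ∘ Φₐ = Φ_{ρ(a)} ∘ φ` for all `a`. -/
def equivariantAut {n : ℕ} {g : KahlerMetric V N} (Φ : Torus n →* g.aut) : Subgroup g.aut where
  carrier := {φ | ∃ ρ : Torus n ≃* Torus n, IsLieGroupIso ρ ∧ ∀ a, φ * Φ a = Φ (ρ a) * φ}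
  one_mem' := ⟨MulEquiv.refl _, ⟨contMDiff_id, contMDiff_id⟩, fun a => by simp⟩
  mul_mem' := by
    rintro φ ψ ⟨ρ, hρ, h⟩ ⟨σ, hσ, k⟩
    refine ⟨σ.trans ρ, ⟨hρ.1.comp hσ.1, hσ.2.comp hρ.2⟩, fun a => ?_⟩
    rw [mul_assoc, k, ← mul_assoc, h, mul_assoc]
    rfl
  inv_mem' := by
    rintro φ ⟨ρ, hρ, h⟩
    refine ⟨ρ.symm, ⟨hρ.2, hρ.1⟩, fun a => ?_⟩
    have := h (ρ.symm a)
    rw [ρ.apply_symm_apply] at this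
    rw [inv_mul_eq_iff_eq_mul, ← mul_assoc, this, mul_assoc, mul_inv_cancel, mul_one]

end Kahler

/-! ### Dually flat manifolds -/

section DuallyFlat

variable {n : ℕ} {M : Type*} [TopologicalSpace M] [ChartedSpace (EuclideanSpace ℝ (Fin n)) M]

variable [IsManifold (𝓡 n) ∞ M]

/-- The vector field `X` is smooth. -/
def SmoothField (X : ∀ p : M, TangentSpace (𝓡 n) p) : Prop :=
  ContMDiff (𝓡 n) (𝓡 n).tangent ∞ (fun p => (⟨p, X p⟩ : TangentBundle (𝓡 n) M))

variable (n M) in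
/-- Riemannian metrics on `M`. -/
abbrev RiemMetric : Type _ :=
  Bundle.ContMDiffRiemannianMetric (𝓡 n) ∞ (EuclideanSpace ℝ (Fin n))
    (fun p : M => TangentSpace (𝓡 n) p)

variable (n M) in
/-- A smooth affine connection on `M`. In `conn Y p v` the vector field `Y` is differentiated in
the direction of the tangent vector `v` at `p`, so `∇_X Y` is `fun p => conn Y p (X p)`. -/
structure AffineConnection where
  conn : CovariantDerivative (𝓡 n) (EuclideanSpace ℝ (Fin n))
    (fun p : M => TangentSpace (𝓡 n) p)
  smooth : CovariantDerivative.ContMDiffCovariantDerivative conn ∞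

/-- The connection is flat: its torsion and its curvature vanish. -/
structure AffineConnection.IsFlat (D : AffineConnection n M) : Prop where
  torsion : D.conn.torsion = 0
  curvature : ∀ X Y Z : ∀ p : M, TangentSpace (𝓡 n) p,
    SmoothField X → SmoothField Y → SmoothField Z → ∀ p : M,
      D.conn (fun q => D.conn Z q (Y q)) p (X p) - D.conn (fun q => D.conn Z q (X q)) p (Y p)
        - D.conn Z p (VectorField.mlieBracket (𝓡 n) X Y p) = 0

/-- `D'` is the dual connection of `D` with respect to `h`:
`X (h(Y, Z)) = h(D_X Y, Z) + h(Y, D'_X Z)`. -/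
def IsDualConnection (h : RiemMetric n M) (D D' : AffineConnection n M) : Prop :=
  ∀ X Y Z : ∀ p : M, TangentSpace (𝓡 n) p, SmoothField X → SmoothField Y → SmoothField Z →
    ∀ p : M, mvfderiv (𝓡 n) (fun q => h.inner q (Y q) (Z q)) p (X p)
      = h.inner p (D.conn Y p (X p)) (Z p) + h.inner p (Y p) (D'.conn Z p (X p))

/-- `(M, h, D)` is dually flat: both `D` and its dual connection are flat. -/
def IsDuallyFlat (h : RiemMetric n M) (D : AffineConnection n M) : Prop :=
  D.IsFlat ∧ ∃ D' : AffineConnection n M, IsDualConnection h D D' ∧ D'.IsFlat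

/-! ### Dombrowski's construction -/

/-- The connector `K_u : T_u(TM) → T_pM`, `u ∈ T_pM`, of the connection `D`. In the coordinates
`(q, r)` of `TM` given by the preferred chart at `p`, it sends `∂/∂q_a` to `D_{∂ₐ} U (p)`, where
`U` is the local vector field with constant components and `U(p) = u`, i.e. to `∑ Γ_{aj}^k u_j ∂ₖ`,
and it sends `∂/∂r_a` to `∂/∂x_a`. -/
def connector (D : AffineConnection n M) (u : TangentBundle (𝓡 n) M)
    (A : TangentSpace (𝓡 n).tangent u) : TangentSpace (𝓡 n) u.proj :=
  let b : TangentSpace (𝓡 n) u.proj := A.2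
  D.conn (FiberBundle.extend (EuclideanSpace ℝ (Fin n)) u.2) u.proj A.1 + b

/-- The derivative at `u` of the projection `π : TM → M`. -/
def projDeriv (u : TangentBundle (𝓡 n) M) (A : TangentSpace (𝓡 n).tangent u) :
    TangentSpace (𝓡 n) u.proj :=
  mfderiv (𝓡 n).tangent (𝓡 n) (Bundle.TotalSpace.proj : TangentBundle (𝓡 n) M → M) u A

/-- The Kähler metric on `TM`: `g_u(A, B) = h(π_* A, π_* B) + h(K A, K B)`. -/
def dombrowskiMetric (h : RiemMetric n M) (D : AffineConnection n M) (u : TangentBundle (𝓡 n) M)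
    (A B : TangentSpace (𝓡 n).tangent u) : ℝ :=
  h.inner u.proj (projDeriv u A) (projDeriv u B)
    + h.inner u.proj (connector D u A) (connector D u B)

/-- `B = J A` for the complex structure `J` on `TM`: under the identification of `T_u(TM)` with
`T_pM ⊕ T_pM` by `A ↦ (π_* A, K A)`, it reads `J (v, w) = (-w, v)`. -/
def IsDombrowskiRotation (D : AffineConnection n M) (u : TangentBundle (𝓡 n) M)
    (A B : TangentSpace (𝓡 n).tangent u) : Prop :=
  projDeriv u B = -connector D u A ∧ connector D u B = projDeriv u A

/-! ### Parallel lattices -/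

/-- Translation `u ↦ u + ∑ tᵢ Xᵢ` in the fibres of `TM`. -/
def frameTranslate (X : Fin n → ∀ p : M, TangentSpace (𝓡 n) p) (t : Fin n → ℝ)
    (u : TangentBundle (𝓡 n) M) : TangentBundle (𝓡 n) M :=
  ⟨u.proj, u.2 + ∑ i, t i • X i u.proj⟩

/-- `L ⊆ TM` is a parallel lattice with respect to `D`, and the frame `X` generates it. -/
structure IsLatticeGenerator (D : AffineConnection n M) (L : Set (TangentBundle (𝓡 n) M))
    (X : Fin n → ∀ p : M, TangentSpace (𝓡 n) p) : Prop where
  smooth : ∀ i, SmoothField (X i)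
  parallel : ∀ i p, D.conn (X i) p = 0
  linearIndependent : ∀ p, LinearIndependent ℝ fun i => X i p
  span : ∀ p, Submodule.span ℝ (Set.range fun i => X i p) = ⊤
  lattice : L = {u | ∃ k : Fin n → ℤ, u.2 = ∑ i, (k i : ℝ) • X i u.proj}

/-- The orbit relation on `TM` of the group `Γ(L)` of translations `u ↦ u + ∑ kᵢ Xᵢ`, `k ∈ ℤⁿ`. -/
def latticeSetoid (X : Fin n → ∀ p : M, TangentSpace (𝓡 n) p) :
    Setoid (TangentBundle (𝓡 n) M) where
  r u v := ∃ k : Fin n → ℤ, v = frameTranslate X (fun i => (k i : ℝ)) u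
  iseqv :=
    { refl := fun u => ⟨0, by simp [frameTranslate]⟩
      symm := by
        rintro ⟨p, w⟩ _ ⟨k, rfl⟩
        refine ⟨-k, congrArg (Bundle.TotalSpace.mk p) ?_⟩
        simp only [Pi.neg_apply, Int.cast_neg, neg_smul, Finset.sum_neg_distrib]
        exact (add_neg_cancel_right w _).symm
      trans := by
        rintro ⟨p, w⟩ _ _ ⟨k, rfl⟩ ⟨l, rfl⟩
        refine ⟨k + l, congrArg (Bundle.TotalSpace.mk p) ?_⟩
        simp only [Pi.add_apply, Int.cast_add, add_smul, Finset.sum_add_distrib]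
        exact add_assoc w _ _ }

/-- The quotient `M_L = TM / Γ(L)`. -/
def LatticeQuotient (X : Fin n → ∀ p : M, TangentSpace (𝓡 n) p) : Type _ :=
  Quotient (latticeSetoid X)

/-- The quotient map `q_L : TM → M_L`. -/
def latticeMk (X : Fin n → ∀ p : M, TangentSpace (𝓡 n) p) (u : TangentBundle (𝓡 n) M) :
    LatticeQuotient X :=
  Quotient.mk (latticeSetoid X) u

/-! ### Torifications -/

variable {V : Type*} [NormedAddCommGroup V] [NormedSpace ℂ V]
  {N : Type*} [TopologicalSpace N] [ChartedSpace V N] [IsManifold 𝓘(ℂ, V) ω N]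

/-- A toric parametrization `(L, X, F)`: a parallel lattice `L ⊆ TM`, a generator `X` of `L` and an
equivariant holomorphic isometric diffeomorphism `F : M_L → N°`. The smooth structure, complex
structure and metric of `M_L` are those for which the covering `q_L : TM → M_L` is a local
diffeomorphism, holomorphic and isometric; so the bijection `F` is a diffeomorphism (holomorphic,
isometric) exactly if `F ∘ q_L : TM → N` is a local diffeomorphism (holomorphic, isometric). -/
structure IsToricParametrization (h : RiemMetric n M) (D : AffineConnection n M)
    (g : KahlerMetric V N) (Φ : Torus n →* g.aut) (L : Set (TangentBundle (𝓡 n) M))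
    (X : Fin n → ∀ p : M, TangentSpace (𝓡 n) p) (F : LatticeQuotient X → freeLocus Φ) : Prop where
  generator : IsLatticeGenerator D L X
  bijective : Function.Bijective F
  diffeo : IsLocalDiffeomorph (𝓡 n).tangent 𝓘(ℝ, V) ∞ fun u => (F (latticeMk X u) : N)
  holomorphic : ∀ (u : TangentBundle (𝓡 n) M) (A B : TangentSpace (𝓡 n).tangent u),
    IsDombrowskiRotation D u A B →
      mfderiv (𝓡 n).tangent 𝓘(ℝ, V) (fun u => (F (latticeMk X u) : N)) u B
        = complexStructure _
          (mfderiv (𝓡 n).tangent 𝓘(ℝ, V) (fun u => (F (latticeMk X u) : N)) u A)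
  isometric : ∀ (u : TangentBundle (𝓡 n) M) (A B : TangentSpace (𝓡 n).tangent u),
    g.metric.inner (F (latticeMk X u) : N)
        (mfderiv (𝓡 n).tangent 𝓘(ℝ, V) (fun u => (F (latticeMk X u) : N)) u A)
        (mfderiv (𝓡 n).tangent 𝓘(ℝ, V) (fun u => (F (latticeMk X u) : N)) u B)
      = dombrowskiMetric h D u A B
  equivariant : ∀ (t : Fin n → ℝ) (u : TangentBundle (𝓡 n) M),
    (F (latticeMk X (frameTranslate X t u)) : N)
      = (Φ (torusMk t) : Equiv.Perm N) (F (latticeMk X u))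

/-- The effective holomorphic isometric torus action `Φ` on `(N, g)` is a torification of
`(M, h, D)`. -/
structure IsTorification (h : RiemMetric n M) (D : AffineConnection n M) (g : KahlerMetric V N)
    (Φ : Torus n →* g.aut) : Prop where
  action : IsEffectiveTorusAction g Φ
  parametrization : ∃ (L : Set (TangentBundle (𝓡 n) M))
    (X : Fin n → ∀ p : M, TangentSpace (𝓡 n) p) (F : LatticeQuotient X → freeLocus Φ),
    IsToricParametrization h D g Φ L X F

end DuallyFlat

end Torification

/-!
Let `φ` normalise the image `S` of the torus. Since `Φ` is injective, conjugation by `φ` induces an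
automorphism `ρ` of the abstract group `𝕋ⁿ`, determined by `φ ∘ Φₐ = Φ_{ρ(a)} ∘ φ`, so everything
comes down to the smoothness of `ρ`.

* `ρ` is continuous: its graph is `{(a, b) | ∀ x, φ (Φₐ x) = Φ_b (φ x)}`, which is closed because
  `N` is Hausdorff and the action and `φ` are continuous, and a map with closed graph into a compact
  space is continuous (`continuous_of_isClosed_graph`).
* A continuous endomorphism of the circle lifts through `exp` to a continuous additive, hence linear,
  map `ℝ → ℝ`, so it is a power map (`Circle.exists_zpow_of_continuous`). Therefore the components of
  `ρ` are Laurent monomials `z ↦ ∏ⱼ zⱼ ^ kⱼ`, which are smooth (`Torus.contMDiff_of_continuous`).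

The same argument, with `φ⁻¹` in place of `φ`, shows that `ρ⁻¹` is smooth.
-/

open scoped Manifold ContDiff Topology

theorem continuous_of_isClosed_graph {X Y : Type*} [TopologicalSpace X] [TopologicalSpace Y]
    [CompactSpace Y] {f : X → Y} (h : IsClosed {p : X × Y | p.2 = f p.1}) : Continuous f := by
  rw [continuous_iff_isClosed]
  intro s hs
  have : f ⁻¹' s = Prod.fst '' ({p : X × Y | p.2 = f p.1} ∩ Prod.snd ⁻¹' s) := by
    ext x
    simp
  rw [this]
  exact isClosedMap_fst_of_compactSpace _ (h.inter (hs.preimage continuous_snd))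

section Pi

variable {ι : Type*} [Fintype ι] {E : ι → Type*} [∀ i, NormedAddCommGroup (E i)]
  [∀ i, NormedSpace ℝ (E i)] {H : ι → Type*} [∀ i, TopologicalSpace (H i)]
  {I : ∀ i, ModelWithCorners ℝ (E i) (H i)} {M : ι → Type*} [∀ i, TopologicalSpace (M i)]
  [∀ i, ChartedSpace (H i) (M i)] {k : WithTop ℕ∞}

theorem contMDiff_apply_piModel (i : ι) :
    ContMDiff (ModelWithCorners.pi I) (I i) k fun x : ∀ i, M i => x i := by
  intro x
  rw [contMDiffAt_iff]
  refine ⟨(continuous_apply i).continuousAt, ?_⟩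
  -- In the product charts the projection is the coordinate expression of the identity of `M i`,
  -- precomposed with the linear projection `∏ E j → E i`.
  have hid := (contMDiffAt_iff.1 (contMDiffAt_id (I := I i) (n := k) (x := x i))).2
  refine ContDiffWithinAt.comp (f := fun v : ∀ j, E j => v i) (t := Set.range (I i))
    (extChartAt (ModelWithCorners.pi I) x x) hid
    (ContinuousLinearMap.proj (R := ℝ) (φ := E) i).contDiff.contDiffWithinAt ?_
  rintro _ ⟨y, rfl⟩
  exact ⟨y i, rfl⟩

theorem contMDiff_piModel {F : Type*} [NormedAddCommGroup F] [NormedSpace ℝ F] {G : Type*}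
    [TopologicalSpace G] {J : ModelWithCorners ℝ F G} {P : Type*} [TopologicalSpace P]
    [ChartedSpace G P] {f : P → ∀ i, M i} (hf : ∀ i, ContMDiff J (I i) k fun x => f x i) :
    ContMDiff J (ModelWithCorners.pi I) k f := by
  intro x
  rw [contMDiffAt_iff]
  refine ⟨(continuous_pi fun i => (hf i).continuous).continuousAt, ?_⟩
  exact contDiffWithinAt_pi.2 fun i => (contMDiffAt_iff.1 (hf i x)).2

end Pi

theorem Circle.exists_zpow_of_continuous (χ : Circle →* Circle) (hχ : Continuous χ) :
    ∃ k : ℤ, ∀ z, χ z = z ^ k := by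
  obtain ⟨F, ⟨hF0, hF⟩, -⟩ := Circle.isCoveringMap_exp.existsUnique_continuousMap_lifts
    (⟨fun t : ℝ => χ (Circle.exp t), by fun_prop⟩ : C(ℝ, Circle)) (a₀ := 0) (e₀ := 0) (by simp)
  have hF' : ∀ t, Circle.exp (F t) = χ (Circle.exp t) := fun t => congrFun hF t
  -- Both sides, as functions of `t`, lift the same map and agree at `0`.
  have hadd : ∀ s t, F (s + t) = F s + F t := by
    intro s t
    refine congrFun (Circle.isCoveringMap_exp.eq_of_comp_eq (g₁ := fun t => F (s + t))
      (g₂ := fun t => F s + F t) (by fun_prop) (by fun_prop) ?_ 0 ?_) t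
    · funext t
      simp [hF', Circle.exp_add]
    · simp [hF0]
  have hlin : ∀ t, F t = t * F 1 := fun t => by
    have := map_real_smul (⟨⟨F, hF0⟩, hadd⟩ : ℝ →+ ℝ) F.continuous t 1
    simpa using this
  -- The slope is an integer because `exp (F (2π)) = χ 1 = 1`.
  obtain ⟨k, hk⟩ := Circle.exp_eq_one.1 ((hF' (2 * Real.pi)).trans (by simp))
  have hk' : F 1 = k := by
    rw [hlin] at hk
    have := Real.pi_ne_zero
    field_simp at hk
    linarith
  refine ⟨k, fun z => ?_⟩
  obtain ⟨t, rfl⟩ := Circle.exp_surjective z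
  rw [← hF', hlin, hk', ← Circle.exp_zsmul]
  simp [mul_comm]

theorem Circle.contMDiff_zpow (k : ℤ) : ContMDiff (𝓡 1) (𝓡 1) ∞ fun z : Circle => z ^ k := by
  have : LieGroup (𝓡 1) ∞ Circle := .of_le (n := ω) le_top
  cases k with
  | ofNat m => simpa using contMDiff_pow (I := 𝓡 1) (n := ∞) (G := Circle) m
  | negSucc m =>
    simpa [zpow_negSucc] using (contMDiff_pow (I := 𝓡 1) (n := ∞) (G := Circle) (m + 1)).inv

namespace Torification

theorem Torus.contMDiff_of_continuous {m n : ℕ} (f : Torus m →* Torus n) (hf : Continuous f) :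
    ContMDiff (torusModel m) (torusModel n) ∞ f := by
  have : ContMDiffMul (𝓡 1) ∞ Circle := .of_le (n := ω) le_top
  refine contMDiff_piModel fun i => ?_
  have hpow : ∀ j, ∃ k : ℤ, ∀ z : Circle, f (Pi.mulSingle j z) i = z ^ k := fun j =>
    Circle.exists_zpow_of_continuous
      ((Pi.evalMonoidHom _ i).comp (f.comp (MonoidHom.mulSingle _ j)))
      ((continuous_apply i).comp (hf.comp (continuous_mulSingle (A := fun _ : Fin m => Circle) j)))
  choose k hk using hpow
  have hmonomial : (fun x => f x i) = fun x => ∏ j, x j ^ k j := by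
    funext x
    conv_lhs => rw [← Finset.univ_prod_mulSingle x, map_prod, Finset.prod_apply]
    exact Finset.prod_congr rfl fun j _ => hk j (x j)
  rw [hmonomial]
  exact contMDiff_finsetProd fun j _ =>
    (Circle.contMDiff_zpow (k j)).comp (contMDiff_apply_piModel j)

section Action

variable {V : Type*} [NormedAddCommGroup V] [NormedSpace ℂ V]
  {N : Type*} [TopologicalSpace N] [T2Space N] [ChartedSpace V N] [IsManifold 𝓘(ℂ, V) ω N]
  {g : KahlerMetric V N} {n : ℕ} {Φ : Torus n →* g.aut}

theorem IsEffectiveTorusAction.continuous_of_intertwines (hΦ : IsEffectiveTorusAction g Φ)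
    {φ : g.aut} {ρ : Torus n → Torus n} (hρ : ∀ a, φ * Φ a = Φ (ρ a) * φ) : Continuous ρ := by
  have hact := hΦ.smooth.continuous
  have hφ : Continuous (φ : Equiv.Perm N) := φ.2.1.continuous
  have hgraph : {p : Torus n × Torus n | p.2 = ρ p.1} = ⋂ x : N, {p | (φ : Equiv.Perm N)
      ((Φ p.1 : Equiv.Perm N) x) = (Φ p.2 : Equiv.Perm N) ((φ : Equiv.Perm N) x)} := by
    ext ⟨a, b⟩
    simp only [Set.mem_ofPred_eq, Set.mem_iInter]
    constructor
    · rintro rfl x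
      exact congrArg (fun ψ : g.aut => (ψ : Equiv.Perm N) x) (hρ a)
    · intro hab
      have hab' : φ * Φ a = Φ b * φ := Subtype.ext (Equiv.ext hab)
      exact hΦ.effective (mul_right_cancel (hab'.symm.trans (hρ a)))
  refine continuous_of_isClosed_graph ?_
  rw [hgraph]
  exact isClosed_iInter fun x => isClosed_eq
    (hφ.comp (hact.comp (continuous_fst.prodMk continuous_const)))
    (hact.comp (continuous_snd.prodMk continuous_const))

theorem IsEffectiveTorusAction.isLieGroupIso_of_intertwines (hΦ : IsEffectiveTorusAction g Φ)
    {φ : g.aut} {ρ : Torus n ≃* Torus n} (hρ : ∀ a, φ * Φ a = Φ (ρ a) * φ) : IsLieGroupIso ρ := by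
  refine ⟨Torus.contMDiff_of_continuous ρ.toMonoidHom (hΦ.continuous_of_intertwines hρ),
    Torus.contMDiff_of_continuous ρ.symm.toMonoidHom
      (hΦ.continuous_of_intertwines (φ := φ⁻¹) fun a => ?_)⟩
  have := hρ (ρ.symm a)
  rw [ρ.apply_symm_apply] at this
  rw [inv_mul_eq_iff_eq_mul, ← mul_assoc]
  exact eq_mul_inv_of_mul_eq this.symm

end Action

end Torification

/-- Conjugation by an element normalising the range of an injective homomorphism, pulled back to
the source. -/
theorem MonoidHom.exists_mulEquiv_of_mem_normalizer_range {T G : Type*} [Group T] [Group G]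
    {Φ : T →* G} (hΦ : Function.Injective Φ) {φ : G}
    (hφ : φ ∈ Subgroup.normalizer (Φ.range : Set G)) :
    ∃ ρ : T ≃* T, ∀ a, φ * Φ a = Φ (ρ a) * φ := by
  have hex : ∀ a, ∃ b, Φ b = φ * Φ a * φ⁻¹ := fun a =>
    (Subgroup.mem_normalizer_iff.1 hφ (Φ a)).1 ⟨a, rfl⟩
  choose ρ hρ using hex
  have hbij : Function.Bijective ρ := by
    refine ⟨fun a b hab => hΦ ?_, fun b => ?_⟩
    · simpa [hρ] using congrArg Φ hab
    · obtain ⟨a, ha⟩ : φ⁻¹ * Φ b * φ ∈ Φ.range :=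
        (Subgroup.mem_normalizer_iff.1 hφ _).2 ⟨b, by group⟩
      exact ⟨a, hΦ (by rw [hρ, ha]; group)⟩
  refine ⟨MulEquiv.ofBijective (MonoidHom.mk' ρ fun a b => hΦ ?_) hbij, fun a => ?_⟩
  · simp [hρ, mul_assoc]
  · change φ * Φ a = Φ (ρ a) * φ
    simp [hρ]

open Torification in
theorem lemma6p4 {n : ℕ}
    {M : Type*} [TopologicalSpace M] [T2Space M] [SecondCountableTopology M] [ConnectedSpace M]
    [ChartedSpace (EuclideanSpace ℝ (Fin n)) M] [IsManifold (𝓡 n) ∞ M]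
    (h : RiemMetric n M) (D : AffineConnection n M) (hM : IsDuallyFlat h D)
    {V : Type*} [NormedAddCommGroup V] [NormedSpace ℂ V] [FiniteDimensional ℂ V]
    (hV : Module.finrank ℂ V = n)
    {N : Type*} [TopologicalSpace N] [T2Space N] [SecondCountableTopology N] [CompactSpace N]
    [ChartedSpace V N] [IsManifold 𝓘(ℂ, V) ω N]
    (g : KahlerMetric V N) (hg : g.IsRegular)
    (Φ : Torus n →* g.aut) (hΦ : IsTorification h D g Φ) :
    Subgroup.normalizer (Φ.range : Set g.aut) = equivariantAut Φ ∧
      ∀ φ ∈ Subgroup.normalizer (Φ.range : Set g.aut),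
        ∃ ρ : Torus n ≃* Torus n, IsLieGroupIso ρ ∧ (∀ a, φ * Φ a = Φ (ρ a) * φ) ∧
          ∀ σ : Torus n → Torus n, (∀ a, φ * Φ a = Φ (σ a) * φ) → σ = ρ := by
  have hact := hΦ.action
  have key : ∀ φ ∈ Subgroup.normalizer (Φ.range : Set g.aut),
      ∃ ρ : Torus n ≃* Torus n, IsLieGroupIso ρ ∧ (∀ a, φ * Φ a = Φ (ρ a) * φ) ∧
        ∀ σ : Torus n → Torus n, (∀ a, φ * Φ a = Φ (σ a) * φ) → σ = ρ := by
    intro φ hφ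
    obtain ⟨ρ, hρ⟩ := MonoidHom.exists_mulEquiv_of_mem_normalizer_range hact.effective hφ
    exact ⟨ρ, hact.isLieGroupIso_of_intertwines hρ, hρ, fun σ hσ => funext fun a =>
      hact.effective (mul_right_cancel ((hσ a).symm.trans (hρ a)))⟩
  refine ⟨le_antisymm (fun φ hφ => ?_) (fun φ hφ => ?_), key⟩
  · obtain ⟨ρ, hρ, hint, -⟩ := key φ hφ
    exact ⟨ρ, hρ, hint⟩
  · obtain ⟨ρ, -, hint⟩ := hφ
    rw [Subgroup.mem_normalizer_iff]
    refine fun ψ => ⟨?_, ?_⟩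
    · rintro ⟨a, rfl⟩
      exact ⟨ρ a, by rw [hint, mul_inv_cancel_right]⟩
    · rintro ⟨b, hb⟩
      refine ⟨ρ.symm b, mul_left_cancel (a := φ) ?_⟩
      rw [hint, ρ.apply_symm_apply, hb, inv_mul_cancel_right]
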